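/- Let $E^{4|8}$ be super Euclidean space: Euclidean space $\mathbb R^4$ with orthonormal basis $v_1,\dots,v_4$ and complex coordinates $y^{a\dot b}$, where $v_1=e_{1\dot1}+e_{2\dot2}$, $v_2=i(e_{1\dot1}-e_{2\dot2})$, $v_3=e_{1\dot2}-e_{2\dot1}$, $v_4=i(e_{1\dot2}+e_{2\dot1})$ and $\partial_{a\dot b}$ is the derivative along $e_{a\dot b}$, together with odd coordinates $\theta^{a(i)},\bar\theta^{\dot a(i)}$ ($a,\dot a,i\in\{1,2\}$). Odd parameters are allowed. Put $$D^{(i)}_a=\partial^{(i)}_a-\bar\theta^{\dot b(i)}\partial_{a\dot b},\qquad \bar D^{(i)}_{\dot a}=\bar\partial^{(i)}_{\dot a}-\theta^{b(i)}\partial_{b\dot a},$$ so that (with anticommutators) $[D_a^{(i)},\bar D_{\dot b}^{(j)}]=-2\delta^{ij}\partial_{a\dot b}$ and the other brackets vanish. Consider a superconnection on an $SU(2)$-bundle over $E^{4|8}$, written in a trivialization (with values in the complexified Lie algebra), and denote horizontal lifts of $D,\bar D,\partial$ by $\mathcal D,\bar{\mathcal D},\nabla$; these act on sections of the adjoint bundle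 by covariant differentiation. Assume that it is *semi-constrained*: its curvature along odd directions vanishes except for $$[\bar{\mathcal D}^{(2)}_{\dot1},\bar{\mathcal D}^{(1)}_{\dot2}]=-[\bar{\mathcal D}^{(2)}_{\dot2},\bar{\mathcal D}^{(1)}_{\dot1}]=\Sigma,\qquad [\mathcal D^{(2)}_1,\mathcal D^{(1)}_2]=-[\mathcal D^{(2)}_2,\mathcal D^{(1)}_1]=\bar\Sigma .$$ With $i^*$ the restriction to $\theta=\bar\theta=0$, let $\sigma=i^*\Sigma$, $\bar\sigma=i^*\bar\Sigma$, and define the auxiliary fields $$E=-i^*(\bar{\mathcal D}^{(1)}_{\dot2}\bar{\mathcal D}^{(2)}_{\dot1}\bar\Sigma-\bar{\mathcal D}^{(1)}_{\dot1}\bar{\mathcal D}^{(2)}_{\dot2}\bar\Sigma),\quad F=i^*\bar{\mathcal D}^{(2)}_{\dot2}\bar{\mathcal D}^{(2)}_{\dot1}\bar\Sigma,\quad \bar F=i^*\bar{\mathcal D}^{(1)}_{\dot1}\bar{\mathcal D}^{(1)}_{\dot2}\bar\Sigma .$$ Twist: regard $(i)$ as a further positive-spinor index, an upper one on $D$ and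 hence (through the bracket) a lower one on $\bar D$; raised, it gives $\bar D^1_{\dot a}=\bar D^{(2)}_{\dot a}$, $\bar D^2_{\dot a}=-\bar D^{(1)}_{\dot a}$. With $D^i_a=D^{(i)}_a$ let $$D_0=D^1_1+D^2_2,$$ $$D_1=(\bar D^1_{\dot2}-\bar D^2_{\dot1})dv^1-i(\bar D^1_{\dot2}+\bar D^2_{\dot1})dv^2-(\bar D^1_{\dot1}+\bar D^2_{\dot2})dv^3+i(\bar D^1_{\dot1}-\bar D^2_{\dot2})dv^4,$$ with horizontal lifts $\mathcal D_0,\mathcal D_1$, and let $\nabla=\sum_\nu\nabla_{v_\nu}dv^\nu$. Put $[\mathcal D_0,\nabla_{v_\nu}]=\frac12(\mathcal D_0\nabla_{v_\nu}-\nabla_{v_\nu}\mathcal D_0)$, let $\epsilon_2$ be the projection of 2-tensors to self-dual 2-vectors $v\otimes w\mapsto v\wedge w+{*}(v\wedge w)$, and let $$E_2=i^*\tfrac12\,\epsilon_2\bigl(\mathcal D_1[\mathcal D_0,\nabla]\bigr).$$ **Proposition.** $E_2$ is the twisted version of the auxiliary fields $E$ and $F$: for every semi-constrained superconnection $$E_2=\tfrac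 i2\bigl(E+[\sigma,\bar\sigma]\bigr)(v_1\wedge v_2+v_3\wedge v_4)-\tfrac12(\bar F-F)(v_1\wedge v_3-v_2\wedge v_4)-\tfrac i2(F+\bar F)(v_1\wedge v_4+v_2\wedge v_3).$$ Here $[\sigma,\bar\sigma]=\sigma\bar\sigma-\bar\sigma\sigma$, and $E+[\sigma,\bar\sigma]$ is $E$ with its odd derivatives antisymmetrized: $$E+[\sigma,\bar\sigma]=-\tfrac12\,i^*\bigl((\bar{\mathcal D}^{(1)}_{\dot2}\bar{\mathcal D}^{(2)}_{\dot1}-\bar{\mathcal D}^{(2)}_{\dot1}\bar{\mathcal D}^{(1)}_{\dot2})\bar\Sigma-(\bar{\mathcal D}^{(1)}_{\dot1}\bar{\mathcal D}^{(2)}_{\dot2}-\bar{\mathcal D}^{(2)}_{\dot2}\bar{\mathcal D}^{(1)}_{\dot1})\bar\Sigma\bigr).$$ Thus up to nonzero constants the three self-dual components of $E_2$ are $\bar F-F$, $F+\bar F$ and (up to operator ordering) $E$. -/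

import Mathlib

open scoped TensorProduct ContDiff

noncomputable section

namespace TwistedSusy

/-! ## Super Euclidean space with eight odd directions

The even part is Euclidean space with its orthonormal basis `v₁, …, v₄` (indices `0, …, 3`).
Spinor indices and the index of the two copies of the spinors run over `Fin 2`
(`0` and `1` for the customary `1` and `2`). -/

/-- Euclidean 4-space. -/
abbrev E4 : Type := EuclideanSpace ℝ (Fin 4)

/-- The algebra of smooth complex valued functions on Euclidean 4-space. -/
def smoothFun : Subalgebra ℂ (E4 → ℂ) where
  carrier := {f | ContDiff ℝ ∞ f}
  mul_mem' {f g} (hf : ContDiff ℝ ∞ f) (hg : ContDiff ℝ ∞ g) := hf.mul hg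
  add_mem' {f g} (hf : ContDiff ℝ ∞ f) (hg : ContDiff ℝ ∞ g) := hf.add hg
  algebraMap_mem' c := (contDiff_const : ContDiff ℝ ∞ (fun _ : E4 => c))

/-- The partial derivative in the direction `v_μ`. -/
def partialFun (μ : Fin 4) : smoothFun →ₗ[ℂ] smoothFun where
  toFun f := ⟨fun x => fderiv ℝ (f : E4 → ℂ) x (EuclideanSpace.single μ 1), by
    have hf : ContDiff ℝ ∞ (f : E4 → ℂ) := f.2
    exact (hf.fderiv_right (m := ∞) (by simp)).clm_apply contDiff_const⟩
  map_add' f g := by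
    have hf : ContDiff ℝ ∞ (f : E4 → ℂ) := f.2
    have hg : ContDiff ℝ ∞ (g : E4 → ℂ) := g.2
    ext x
    have := fderiv_add (hf.differentiable (by simp) x) (hg.differentiable (by simp) x)
    simp [this]
  map_smul' c f := by
    have hf : ContDiff ℝ ∞ (f : E4 → ℂ) := f.2
    ext x
    have := fderiv_const_smul (hf.differentiable (by simp) x) c
    simp [this]

/-- Indices of the odd generators: the coordinates `θ^{a(i)}` (index `(i, a)`), the coordinates
`θ̄^{ȧ(i)}` (index `(i, a)`), and `N` odd parameters. The parameters are the coordinates of an odd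
base space over which everything is allowed to vary (so that fermionic fields can be nonzero);
`N = 0` is the case of a single connection. -/
abbrev OddIdx (N : ℕ) : Type := (Fin 2 × Fin 2) ⊕ (Fin 2 × Fin 2) ⊕ Fin N

/-- Superfunctions: smooth functions tensored with the exterior algebra on the odd generators. -/
def SFun (N : ℕ) : Type := smoothFun ⊗[ℂ] ExteriorAlgebra ℂ (OddIdx N → ℂ)

/-- Superfunctions restricted to the even subspace `θ = θ̄ = 0`: only the parameters are left. -/
def BFun (N : ℕ) : Type := smoothFun ⊗[ℂ] ExteriorAlgebra ℂ (Fin N → ℂ)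

/-! The algebra structures on superfunctions are those of the tensor products. -/

instance instRingSFun (N : ℕ) : Ring (SFun N) :=
  inferInstanceAs (Ring (smoothFun ⊗[ℂ] ExteriorAlgebra ℂ (OddIdx N → ℂ)))

instance instAlgebraSFun (N : ℕ) : Algebra ℂ (SFun N) :=
  inferInstanceAs (Algebra ℂ (smoothFun ⊗[ℂ] ExteriorAlgebra ℂ (OddIdx N → ℂ)))

instance instRingBFun (N : ℕ) : Ring (BFun N) :=
  inferInstanceAs (Ring (smoothFun ⊗[ℂ] ExteriorAlgebra ℂ (Fin N → ℂ)))

instance instAlgebraBFun (N : ℕ) : Algebra ℂ (BFun N) :=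
  inferInstanceAs (Algebra ℂ (smoothFun ⊗[ℂ] ExteriorAlgebra ℂ (Fin N → ℂ)))

instance instAddCommGroupSFun (N : ℕ) : AddCommGroup (SFun N) := (instRingSFun N).toAddCommGroup
instance instAddCommMonoidSFun (N : ℕ) : AddCommMonoid (SFun N) := (instAddCommGroupSFun N).toAddCommMonoid
instance instModuleSFun (N : ℕ) : Module ℂ (SFun N) := (instAlgebraSFun N).toModule

/-- The parity automorphism: `1` on even and `-1` on odd superfunctions. -/
def parity (N : ℕ) : SFun N →ₐ[ℂ] SFun N :=
  Algebra.TensorProduct.map (AlgHom.id ℂ smoothFun) CliffordAlgebra.involute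

/-- Restriction to the even subspace. -/
def restrictFun (N : ℕ) : SFun N →ₐ[ℂ] BFun N :=
  Algebra.TensorProduct.map (AlgHom.id ℂ smoothFun)
    (ExteriorAlgebra.map (LinearMap.funLeft ℂ ℂ (fun k : Fin N => Sum.inr (Sum.inr k))))

/-- The index of `θ^{a(i)}`. -/
def th {N : ℕ} (i a : Fin 2) : OddIdx N := Sum.inl (i, a)

/-- The index of `θ̄^{ȧ(i)}`. -/
def thbar {N : ℕ} (i a : Fin 2) : OddIdx N := Sum.inr (Sum.inl (i, a))

variable {N : ℕ}

/-- The even vector field `∂_{v_μ}`. -/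
def dEven (μ : Fin 4) : Module.End ℂ (SFun N) :=
  LinearMap.rTensor (ExteriorAlgebra ℂ (OddIdx N → ℂ)) (partialFun μ)

/-- The odd (left) partial derivative with respect to an odd generator. -/
def dOdd (k : OddIdx N) : Module.End ℂ (SFun N) :=
  LinearMap.lTensor smoothFun
    (CliffordAlgebra.contractLeft (Q := (0 : QuadraticForm ℂ (OddIdx N → ℂ)))
      (LinearMap.proj k : (OddIdx N → ℂ) →ₗ[ℂ] ℂ))

/-- Left multiplication by an odd generator. -/
def mulOdd (k : OddIdx N) : Module.End ℂ (SFun N) :=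
  LinearMap.mulLeft ℂ ((1 : smoothFun) ⊗ₜ[ℂ] ExteriorAlgebra.ι ℂ (Pi.single k (1 : ℂ)))

/-- The complex vector field `∂_{aḃ}` in the direction `e_{aḃ}`, where
`v₁ = e₁₁ + e₂₂`, `v₂ = i e₁₁ - i e₂₂`, `v₃ = e₁₂ - e₂₁`, `v₄ = i e₁₂ + i e₂₁`. -/
def dSpin (a b : Fin 2) : Module.End ℂ (SFun N) :=
  ![![(1 / 2 : ℂ) • (dEven 0 - Complex.I • dEven 1),
      (1 / 2 : ℂ) • (dEven 2 - Complex.I • dEven 3)],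
    ![(1 / 2 : ℂ) • (-dEven 2 - Complex.I • dEven 3),
      (1 / 2 : ℂ) • (dEven 0 + Complex.I • dEven 1)]] a b

/-- `D_a^{(i)} = ∂_a^{(i)} - θ̄^{ḃ(i)} ∂_{aḃ}`. -/
def D (i a : Fin 2) : Module.End ℂ (SFun N) :=
  dOdd (th i a) - ∑ b : Fin 2, mulOdd (thbar i b) * dSpin a b

/-- `D̄_ȧ^{(i)} = ∂̄_ȧ^{(i)} - θ^{b(i)} ∂_{bȧ}`. -/
def Dbar (i a : Fin 2) : Module.End ℂ (SFun N) :=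
  dOdd (thbar i a) - ∑ b : Fin 2, mulOdd (th i b) * dSpin b a

/-! ## Superconnections

A principal `SU(2)`-bundle over this superspace is trivial, so everything is written in a
trivialization. The sections of the complexified adjoint bundle are the traceless `2 × 2` matrices
of superfunctions. -/

/-- `2 × 2` matrices of superfunctions. -/
abbrev SMat (N : ℕ) : Type := Matrix (Fin 2) (Fin 2) (SFun N)

/-- `2 × 2` matrices of functions on the even subspace. -/
abbrev BMat (N : ℕ) : Type := Matrix (Fin 2) (Fin 2) (BFun N)

/-- A matrix all of whose entries are even. -/
def IsEvenMat (s : SMat N) : Prop := ∀ p q, parity N (s p q) = s p q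

/-- A matrix all of whose entries are odd. -/
def IsOddMat (s : SMat N) : Prop := ∀ p q, parity N (s p q) = -s p q

/-- Pullback `i^*` of sections of the adjoint bundle to the even subspace. -/
def restrict (s : SMat N) : BMat N := s.map (restrictFun N)

/-- Invariant vector fields on the total space of the (trivialized) bundle: a pair `(X, s)` stands
for `X + s`, with `X` a vector field on the base and `s` vertical. -/
abbrev InvField (N : ℕ) : Type := Module.End ℂ (SFun N) × SMat N

/-- A section of the adjoint bundle as a vertical invariant vector field. -/
def vert (s : SMat N) : InvField N := (0, s)

/-- The bracket `PQ + QP` of two odd invariant vector fields. -/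
def acomm (P Q : InvField N) : InvField N :=
  (P.1 * Q.1 + Q.1 * P.1, Q.2.map P.1 + P.2.map Q.1 + P.2 * Q.2 + Q.2 * P.2)

/-- The bracket `PQ - QP` of two invariant vector fields, one of which is even. -/
def comm (P Q : InvField N) : InvField N :=
  (P.1 * Q.1 - Q.1 * P.1, Q.2.map P.1 - P.2.map Q.1 + P.2 * Q.2 - Q.2 * P.2)

/-- A superconnection, given by the values of its (even) connection form on the frame
`D_a^{(i)}`, `D̄_ȧ^{(i)}`, `∂_{aḃ}`. -/
structure SuperConnection (N : ℕ) where
  /-- the value on `D_a^{(i)}` -/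
  A : Fin 2 → Fin 2 → SMat N
  /-- the value on `D̄_ȧ^{(i)}` -/
  Abar : Fin 2 → Fin 2 → SMat N
  /-- the value on `∂_{aḃ}` -/
  Aeven : Fin 2 → Fin 2 → SMat N
  odd_A : ∀ i a, IsOddMat (A i a)
  odd_Abar : ∀ i a, IsOddMat (Abar i a)
  even_Aeven : ∀ a b, IsEvenMat (Aeven a b)
  trace_A : ∀ i a, (A i a).trace = 0
  trace_Abar : ∀ i a, (Abar i a).trace = 0
  trace_Aeven : ∀ a b, (Aeven a b).trace = 0

namespace SuperConnection

variable (Γ : SuperConnection N)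

/-- The horizontal lift of `D_a^{(i)}`. -/
def hD (i a : Fin 2) : InvField N := (D i a, Γ.A i a)

/-- The horizontal lift of `D̄_ȧ^{(i)}`. -/
def hDbar (i a : Fin 2) : InvField N := (Dbar i a, Γ.Abar i a)

/-- The horizontal lift of `∂_{aḃ}`. -/
def hSpin (a b : Fin 2) : InvField N := (dSpin a b, Γ.Aeven a b)

/-- The curvature on `D_a^{(i)}, D_b^{(j)}` (whose bracket vanishes). -/
def curvDD (i a j b : Fin 2) : SMat N := (acomm (Γ.hD i a) (Γ.hD j b)).2

/-- The curvature on `D̄_ȧ^{(i)}, D̄_ḃ^{(j)}` (whose bracket vanishes). -/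
def curvDbarDbar (i a j b : Fin 2) : SMat N := (acomm (Γ.hDbar i a) (Γ.hDbar j b)).2

/-- The curvature on `D_a^{(i)}, D̄_ḃ^{(j)}` (whose bracket is `-2 δ^{ij} ∂_{aḃ}`). -/
def curvDDbar (i a j b : Fin 2) : SMat N :=
  (acomm (Γ.hD i a) (Γ.hDbar j b)).2 - (if i = j then (-2 : ℂ) else 0) • Γ.Aeven a b

/-- `Σ = [𝒟̄_1̇^{(2)}, 𝒟̄_2̇^{(1)}]`. -/
def Sig : SMat N := Γ.curvDbarDbar 1 0 0 1

/-- `Σ̄ = [𝒟_1^{(2)}, 𝒟_2^{(1)}]`. -/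
def SigBar : SMat N := Γ.curvDD 1 0 0 1

end SuperConnection

/-- The antisymmetric symbol with `ε_{12} = 1`. -/
def eps2d : Matrix (Fin 2) (Fin 2) ℂ := !![0, 1; -1, 0]

/-- Semi-constrained superconnections: along the odd directions the curvature vanishes, except for
the two components
`[𝒟̄_1̇^{(2)}, 𝒟̄_2̇^{(1)}] = -[𝒟̄_2̇^{(2)}, 𝒟̄_1̇^{(1)}] = Σ` and
`[𝒟_1^{(2)}, 𝒟_2^{(1)}] = -[𝒟_2^{(2)}, 𝒟_1^{(1)}] = Σ̄`. -/
structure SuperConnection.IsSemiConstrained (Γ : SuperConnection N) : Prop where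
  curvDD : ∀ i a j b, Γ.curvDD i a j b = -(eps2d a b * eps2d i j) • Γ.SigBar
  curvDbarDbar : ∀ i a j b, Γ.curvDbarDbar i a j b = -(eps2d a b * eps2d i j) • Γ.Sig
  curvDDbar : ∀ i a j b, Γ.curvDDbar i a j b = 0

namespace SuperConnection

variable (Γ : SuperConnection N)

/-! ## Component fields in flat space -/

/-- The second covariant derivative `𝒟̄_ȧ^{(i)} 𝒟̄_ḃ^{(j)} Σ̄` (here `Σ̄` is even and
`𝒟̄_ḃ^{(j)} Σ̄` is odd). -/
def ddSigBar (i a j b : Fin 2) : SMat N :=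
  (acomm (Γ.hDbar i a) (comm (Γ.hDbar j b) (vert Γ.SigBar))).2

/-- `σ = i^* Σ`. -/
def sigma : BMat N := restrict Γ.Sig

/-- `σ̄ = i^* Σ̄`. -/
def sigmaBar : BMat N := restrict Γ.SigBar

/-- `E = -i^*(𝒟̄_2̇^{(1)} 𝒟̄_1̇^{(2)} Σ̄ - 𝒟̄_1̇^{(1)} 𝒟̄_2̇^{(2)} Σ̄)`. -/
def auxE : BMat N := -restrict (Γ.ddSigBar 0 1 1 0 - Γ.ddSigBar 0 0 1 1)

/-- `E` with its two odd derivatives antisymmetrized: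
`-½ i^*((𝒟̄_2̇^{(1)} 𝒟̄_1̇^{(2)} - 𝒟̄_1̇^{(2)} 𝒟̄_2̇^{(1)}) Σ̄
  - (𝒟̄_1̇^{(1)} 𝒟̄_2̇^{(2)} - 𝒟̄_2̇^{(2)} 𝒟̄_1̇^{(1)}) Σ̄)`. -/
def auxEAnti : BMat N :=
  -restrict ((1 / 2 : ℂ) • ((Γ.ddSigBar 0 1 1 0 - Γ.ddSigBar 1 0 0 1)
    - (Γ.ddSigBar 0 0 1 1 - Γ.ddSigBar 1 1 0 0)))

/-- `F = i^* 𝒟̄_2̇^{(2)} 𝒟̄_1̇^{(2)} Σ̄`. -/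
def auxF : BMat N := restrict (Γ.ddSigBar 1 1 1 0)

/-- `F̄ = i^* 𝒟̄_1̇^{(1)} 𝒟̄_2̇^{(1)} Σ̄`. -/
def auxFbar : BMat N := restrict (Γ.ddSigBar 0 0 0 1)

/-! ## The twist

The index `(i)` of the two copies becomes an index of a further copy of the positive spinors. -/

/-- The horizontal lift of `D̄` with upper twisted index. The bracket pairs `D^{(i)}` with `D̄^{(i)}`
through `δ^{ij}`, so when `(i)` on `D` is an upper index, `(i)` on `D̄` is a lower one. It is
raised by `e_1 ↦ -e^2`, `e_2 ↦ e^1`, so that `D̄_{(1)} = -D̄^2` and `D̄_{(2)} = D̄^1`. -/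
def hDbarUp (i a : Fin 2) : InvField N := ![Γ.hDbar 1 a, -Γ.hDbar 0 a] i

/-- `𝒟₀`, the lift of `D₀ = D^1_1 + D^2_2`. -/
def hD0 : InvField N := Γ.hD 0 0 + Γ.hD 1 1

/-- The components of `𝒟₁` with respect to `dv^1, …, dv^4`: the lifts of
`D̄^1_2̇ - D̄^2_1̇`, `-i D̄^1_2̇ - i D̄^2_1̇`, `-D̄^1_1̇ - D̄^2_2̇`, `i D̄^1_1̇ - i D̄^2_2̇`. -/
def hD1 (μ : Fin 4) : InvField N :=
  ![Γ.hDbarUp 0 1 - Γ.hDbarUp 1 0,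
    -(Complex.I • Γ.hDbarUp 0 1) - Complex.I • Γ.hDbarUp 1 0,
    -Γ.hDbarUp 0 0 - Γ.hDbarUp 1 1,
    Complex.I • Γ.hDbarUp 0 0 - Complex.I • Γ.hDbarUp 1 1] μ

/-- The components of `∇`, the horizontal lift of the de Rham differential: the lifts of
`∂_{v_1}, …, ∂_{v_4}`. -/
def hNabla (μ : Fin 4) : InvField N :=
  ![Γ.hSpin 0 0 + Γ.hSpin 1 1,
    Complex.I • Γ.hSpin 0 0 - Complex.I • Γ.hSpin 1 1,
    Γ.hSpin 0 1 - Γ.hSpin 1 0,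
    Complex.I • Γ.hSpin 0 1 + Complex.I • Γ.hSpin 1 0] μ

end SuperConnection

/-- The Hodge star on antisymmetric tensors `B = ∑_{μ<ν} B_{μν} v_μ ∧ v_ν` on Euclidean 4-space. -/
def hodge {L : Type*} [AddCommGroup L] (B : Fin 4 → Fin 4 → L) : Fin 4 → Fin 4 → L :=
  ![![0, B 2 3, -B 1 3, B 1 2],
    ![-B 2 3, 0, B 0 3, -B 0 2],
    ![B 1 3, -B 0 3, 0, B 0 1],
    ![-B 1 2, B 0 2, -B 0 1, 0]]

/-- The projection `ε₂` of 2-tensors to self-dual 2-vectors, `v ⊗ w ↦ v ∧ w + *(v ∧ w)`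
(so `v₁ ⊗ v₂ ↦ v₁ ∧ v₂ + v₃ ∧ v₄`). -/
def eps2 {L : Type*} [AddCommGroup L] (T : Fin 4 → Fin 4 → L) : Fin 4 → Fin 4 → L :=
  (fun μ ν => T μ ν - T ν μ) + hodge (fun μ ν => T μ ν - T ν μ)

/-- `v₁ ∧ v₂ + v₃ ∧ v₄`. -/
def omega1 : Matrix (Fin 4) (Fin 4) ℂ := !![0, 1, 0, 0; -1, 0, 0, 0; 0, 0, 0, 1; 0, 0, -1, 0]

/-- `v₁ ∧ v₃ - v₂ ∧ v₄`. -/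
def omega2 : Matrix (Fin 4) (Fin 4) ℂ := !![0, 0, 1, 0; 0, 0, 0, -1; -1, 0, 0, 0; 0, 1, 0, 0]

/-- `v₁ ∧ v₄ + v₂ ∧ v₃`. -/
def omega3 : Matrix (Fin 4) (Fin 4) ℂ := !![0, 0, 0, 1; 0, 0, 1, 0; 0, -1, 0, 0; -1, 0, 0, 0]

/-- `[𝒟₀, ∇_ν]` for the normalized bracket `[A, B] = ½ (AB - (-1)^{π(A)π(B)} BA)`. It is vertical
because `D₀` commutes with `∂_{v_ν}`. -/
def SuperConnection.brD0Nabla (Γ : SuperConnection N) (ν : Fin 4) : SMat N :=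
  (1 / 2 : ℂ) • (comm Γ.hD0 (Γ.hNabla ν)).2

/-- `E₂ = i^* ½ ε₂(𝒟₁[𝒟₀, ∇])`, a self-dual 2-vector with values in the adjoint bundle, where
`𝒟₁` acts on the odd section `[𝒟₀, ∇]` by covariant differentiation. -/
def SuperConnection.E2 (Γ : SuperConnection N) (μ ν : Fin 4) : BMat N :=
  restrict ((1 / 2 : ℂ) •
    eps2 (fun α β => (acomm (Γ.hD1 α) (vert (Γ.brD0Nabla β))).2) μ ν)

end TwistedSusy

end

noncomputable section

namespace TwistedSusy

variable {N : ℕ}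

/-! The formula comes from two applications of the super Jacobi identity and a decomposition of
2-tensors into spinors. By semi-constraint, the bracket of `hD i a` with `hDbar i b` is -2 times the
lift of `∂_{aḃ}`, while operators from different copies have vanishing mixed bracket. Commuting `hD
j c`, `j ≠ i`, past this bracket leaves only the term with the `D`-`D` bracket, so the curvature on
`D_c^{(j)}, ∂_{aḃ}` is a multiple of a derivative of `SigBar`. In the sum defining `hD0` exactly one
summand survives for each `a`, and the spinor index becomes the copy index: the bracket with
`∂_{aḃ}` is -1/2 `dSigBar a b` (`hD0_comm_hSpin`).

Since `hD1` is the vector with spinor components `hDbar i a`, the tensor inside `E2` has spinor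
components proportional to `ddSigBar i a j b` (`hD1_brD0Nabla`). A second Jacobi identity
(`ddSigBar_add_swap`) shows that its symmetric part is a multiple of the metric, with coefficient a
commutator of `Sig` and `SigBar`. The self-dual projection keeps what is symmetric in the copy
indices and skew in the dotted ones: the copies 11 and 22 give `auxFbar` and `auxF`, and the mixed
ones give `auxE` with the commutator as ordering correction (`eps2_vecComp`).

The Jacobi identities are proved by letting invariant fields act on sections of the defining
representation (`act`). Brackets become commutators or anticommutators in an associative algebra,
and nothing is lost because vertical fields act faithfully. -/

/-! ### Pure tensors and the calculus of the exterior algebra. -/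

/-- The exterior algebra on the odd generators. -/
abbrev Ext (N : ℕ) : Type := ExteriorAlgebra ℂ (OddIdx N → ℂ)

/-- A pure tensor, as a superfunction. -/
def tm (f : smoothFun) (w : Ext N) : SFun N := f ⊗ₜ[ℂ] w

/-- No zero case is needed, since zero is itself a pure tensor. -/
theorem SFun.induction {p : SFun N → Prop} (x : SFun N) (tm : ∀ f w, p (tm f w))
    (add : ∀ x y, p x → p y → p (x + y)) : p x :=
  TensorProduct.induction_on (motive := p) x (by
    have h := tm 0 0
    have e : (TwistedSusy.tm 0 0 : SFun N) = (0 : smoothFun ⊗[ℂ] Ext N) :=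
      TensorProduct.zero_tmul _ _
    rwa [e] at h) tm add

theorem end_ext {X Y : Module.End ℂ (SFun N)} (h : ∀ f w, X (tm f w) = Y (tm f w)) : X = Y :=
  LinearMap.ext fun x => SFun.induction (p := fun x => X x = Y x) x h
    fun x y hx hy => by rw [map_add, map_add, hx, hy]

theorem tm_mul (f g : smoothFun) (w v : Ext N) : tm f w * tm g v = tm (f * g) (w * v) :=
  Algebra.TensorProduct.tmul_mul_tmul f g w v

theorem tm_add (f : smoothFun) (w v : Ext N) : tm f (w + v) = tm f w + tm f v :=
  TensorProduct.tmul_add f w v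

theorem tm_neg (f : smoothFun) (w : Ext N) : tm f (-w) = -tm f w :=
  TensorProduct.tmul_neg f w

theorem tm_zero (f : smoothFun) : tm f (0 : Ext N) = 0 :=
  TensorProduct.tmul_zero _ f

theorem add_tm (f g : smoothFun) (w : Ext N) : tm (f + g) w = tm f w + tm g w :=
  TensorProduct.add_tmul f g w

theorem parity_tm (f : smoothFun) (w : Ext N) :
    parity N (tm f w) = tm f (CliffordAlgebra.involute w) := rfl

theorem dEven_tm (μ : Fin 4) (f : smoothFun) (w : Ext N) :
    dEven μ (tm f w) = tm (partialFun μ f) w := rfl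

/-- Contraction of the exterior algebra with the coordinate `k`. -/
def contr (k : OddIdx N) : Module.End ℂ (Ext N) :=
  CliffordAlgebra.contractLeft (Q := (0 : QuadraticForm ℂ (OddIdx N → ℂ)))
      (LinearMap.proj k : (OddIdx N → ℂ) →ₗ[ℂ] ℂ)

/-- The odd generator with index `k`. -/
def gen (k : OddIdx N) : Ext N := ExteriorAlgebra.ι ℂ (Pi.single k (1 : ℂ))

theorem dOdd_tm (k : OddIdx N) (f : smoothFun) (w : Ext N) :
    dOdd k (tm f w) = tm f (contr k w) := rfl

theorem mulOdd_apply (k : OddIdx N) (x : SFun N) : mulOdd k x = tm 1 (gen k) * x := rfl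

theorem mulOdd_tm (k : OddIdx N) (f : smoothFun) (w : Ext N) :
    mulOdd k (tm f w) = tm f (gen k * w) := by
  rw [mulOdd_apply, tm_mul, one_mul]

/-- The graded Leibniz rule follows from the case of a generator. The product case applies the
hypothesis for `a` to the factor `b * v`, so `v` must stay general. -/
theorem contr_mul (k : OddIdx N) (w v : Ext N) :
    contr k (w * v) = contr k w * v + CliffordAlgebra.involute w * contr k v := by
  induction w using CliffordAlgebra.induction generalizing v with
  | algebraMap r =>
    simp [contr, CliffordAlgebra.contractLeft_algebraMap_mul,
      CliffordAlgebra.contractLeft_algebraMap]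
  | ι x =>
    simp [contr, CliffordAlgebra.contractLeft_ι_mul, CliffordAlgebra.contractLeft_ι,
      Algebra.smul_def, sub_eq_add_neg]
  | mul a b ha hb =>
    rw [mul_assoc, ha, hb, ha b, map_mul]
    noncomm_ring
  | add a b ha hb =>
    rw [add_mul, map_add, ha, hb, map_add, map_add]
    noncomm_ring

theorem involute_contr (k : OddIdx N) (w : Ext N) :
    CliffordAlgebra.involute (contr k w) = -contr k (CliffordAlgebra.involute w) := by
  induction w using CliffordAlgebra.induction with
  | algebraMap r => simp [contr, CliffordAlgebra.contractLeft_algebraMap]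
  | ι x => simp [contr, CliffordAlgebra.contractLeft_ι]
  | mul a b ha hb =>
    rw [contr_mul, map_add, map_mul, map_mul, ha, hb, map_mul, contr_mul]
    noncomm_ring
  | add a b ha hb => rw [map_add, map_add, ha, hb, map_add, map_add, neg_add]

theorem gen_mul (k : OddIdx N) (w : Ext N) :
    gen k * w = CliffordAlgebra.involute w * gen k := by
  induction w using CliffordAlgebra.induction with
  | algebraMap r => simpa using (Algebra.commutes r (gen k)).symm
  | ι x =>
    rw [CliffordAlgebra.involute_ι, neg_mul, eq_neg_iff_add_eq_zero]
    exact ExteriorAlgebra.ι_add_mul_swap _ _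
  | mul a b ha hb => rw [← mul_assoc, ha, mul_assoc, hb, ← mul_assoc, map_mul]
  | add a b ha hb => rw [mul_add, ha, hb, map_add, add_mul]

theorem involute_gen (k : OddIdx N) : CliffordAlgebra.involute (gen k) = -gen k :=
  CliffordAlgebra.involute_ι _

theorem contr_gen (k l : OddIdx N) : contr k (gen l) = if k = l then 1 else 0 := by
  have h : contr k (gen l) = algebraMap ℂ _ ((Pi.single l (1 : ℂ) : OddIdx N → ℂ) k) :=
    CliffordAlgebra.contractLeft_ι _ _ _
  rw [h, Pi.single_apply]
  split_ifs <;> simp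

/-! ### Commutation relations of the elementary operators. -/

theorem dOdd_mul_dOdd (k l : OddIdx N) : dOdd k * dOdd l = -(dOdd l * dOdd k) :=
  end_ext fun f w => by
    simp only [Module.End.mul_apply, LinearMap.neg_apply, dOdd_tm, ← tm_neg]
    exact congrArg _ (CliffordAlgebra.contractLeft_comm _ _ _)

theorem mulOdd_mul_mulOdd (k l : OddIdx N) : mulOdd k * mulOdd l = -(mulOdd l * mulOdd k) :=
  end_ext fun f w => by
    simp only [Module.End.mul_apply, LinearMap.neg_apply, mulOdd_tm, ← tm_neg]
    rw [← mul_assoc, gen_mul k (gen l), involute_gen, neg_mul, neg_mul, mul_assoc]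

theorem dOdd_mul_mulOdd (k l : OddIdx N) :
    dOdd k * mulOdd l = (if k = l then 1 else 0) - mulOdd l * dOdd k :=
  end_ext fun f w => by
    simp only [Module.End.mul_apply, LinearMap.sub_apply, mulOdd_tm, dOdd_tm, contr_mul, contr_gen,
      involute_gen, tm_add, neg_mul, tm_neg]
    split_ifs <;> simp [tm_zero, sub_eq_add_neg]

theorem dEven_mul_dOdd (μ : Fin 4) (k : OddIdx N) : dEven μ * dOdd k = dOdd k * dEven μ :=
  end_ext fun _ _ => rfl

theorem dEven_mul_mulOdd (μ : Fin 4) (k : OddIdx N) : dEven μ * mulOdd k = mulOdd k * dEven μ :=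
  end_ext fun f w => by
    simp only [Module.End.mul_apply, mulOdd_tm, dEven_tm]

theorem partialFun_comm (μ ν : Fin 4) (f : smoothFun) :
    partialFun μ (partialFun ν f) = partialFun ν (partialFun μ f) := by
  have hf : ContDiff ℝ ∞ (f : E4 → ℂ) := f.2
  have hd : Differentiable ℝ (fderiv ℝ (f : E4 → ℂ)) :=
    (hf.fderiv_right (m := ∞) (by simp)).differentiable (by simp)
  have key (μ ν : Fin 4) (x : E4) : ((partialFun μ (partialFun ν f) : smoothFun) : E4 → ℂ) x =
      fderiv ℝ (fderiv ℝ (f : E4 → ℂ)) x (EuclideanSpace.single μ 1)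
        (EuclideanSpace.single ν 1) := by
    change fderiv ℝ (fun y => fderiv ℝ (f : E4 → ℂ) y (EuclideanSpace.single ν 1)) x _ = _
    rw [fderiv_clm_apply (hd x) (differentiableAt_const _)]
    simp
  ext x
  rw [key, key]
  exact (hf.contDiffAt.isSymmSndFDerivAt
    (by simpa using WithTop.coe_le_coe.2 (le_top : (2 : ℕ∞) ≤ ⊤))) _ _

theorem partialFun_mul (μ : Fin 4) (f g : smoothFun) :
    partialFun μ (f * g) = partialFun μ f * g + f * partialFun μ g := by
  have hf : ContDiff ℝ ∞ (f : E4 → ℂ) := f.2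
  have hg : ContDiff ℝ ∞ (g : E4 → ℂ) := g.2
  ext x
  have := fderiv_mul (hf.differentiable (by simp) x) (hg.differentiable (by simp) x)
  change fderiv ℝ ((f : E4 → ℂ) * (g : E4 → ℂ)) x _ = fderiv ℝ (f : E4 → ℂ) x _ * _ +
    _ * fderiv ℝ (g : E4 → ℂ) x _
  rw [this]
  simp
  ring

theorem dEven_comm (μ ν : Fin 4) :
    (dEven μ * dEven ν : Module.End ℂ (SFun N)) = dEven ν * dEven μ :=
  end_ext fun f w => by
    simp only [Module.End.mul_apply, dEven_tm, partialFun_comm μ ν]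

theorem dSpin_mul_dOdd (a b : Fin 2) (k : OddIdx N) : dSpin a b * dOdd k = dOdd k * dSpin a b := by
  fin_cases a <;> fin_cases b <;>
    simp [dSpin, mul_add, add_mul, mul_sub, sub_mul, dEven_mul_dOdd]

theorem dSpin_mul_mulOdd (a b : Fin 2) (k : OddIdx N) :
    dSpin a b * mulOdd k = mulOdd k * dSpin a b := by
  fin_cases a <;> fin_cases b <;>
    simp [dSpin, mul_add, add_mul, mul_sub, sub_mul, dEven_mul_mulOdd]

theorem dSpin_comm (a b c d : Fin 2) :
    (dSpin a b * dSpin c d : Module.End ℂ (SFun N)) = dSpin c d * dSpin a b := by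
  have h (a b : Fin 2) (μ : Fin 4) : Commute (dSpin a b : Module.End ℂ (SFun N)) (dEven μ) := by
    have h' (ν : Fin 4) : Commute (dEven ν : Module.End ℂ (SFun N)) (dEven μ) := dEven_comm ν μ
    fin_cases a <;> fin_cases b
    · exact ((h' 0).sub_left ((h' 1).smul_left _)).smul_left _
    · exact ((h' 2).sub_left ((h' 3).smul_left _)).smul_left _
    · exact ((h' 2).neg_left.sub_left ((h' 3).smul_left _)).smul_left _
    · exact ((h' 0).add_left ((h' 1).smul_left _)).smul_left _
  have h' := h a b
  change Commute _ _
  fin_cases c <;> fin_cases d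
  · exact ((h' 0).sub_right ((h' 1).smul_right _)).smul_right _
  · exact ((h' 2).sub_right ((h' 3).smul_right _)).smul_right _
  · exact ((h' 2).neg_right.sub_right ((h' 3).smul_right _)).smul_right _
  · exact ((h' 0).add_right ((h' 1).smul_right _)).smul_right _

/-! ### Brackets of the fields `D`, `Dbar` and `dSpin`. -/

theorem th_ne_thbar (i a j b : Fin 2) : (th i a : OddIdx N) ≠ thbar j b := Sum.inl_ne_inr

theorem thbar_inj {i a j b : Fin 2} : (thbar i a : OddIdx N) = thbar j b ↔ i = j ∧ a = b := by
  simp [thbar]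

theorem th_inj {i a j b : Fin 2} : (th i a : OddIdx N) = th j b ↔ i = j ∧ a = b := by
  simp [th]

/-- The anticommutator of two twisted odd vector fields of the form `∂ - θ X`. -/
theorem anticomm_sub_mulOdd_mul {k l : OddIdx N} {p q : Fin 2 → OddIdx N}
    {X Y : Fin 2 → Module.End ℂ (SFun N)}
    (hXd : ∀ i k, X i * dOdd k = dOdd k * X i) (hXm : ∀ i k, X i * mulOdd k = mulOdd k * X i)
    (hYd : ∀ i k, Y i * dOdd k = dOdd k * Y i) (hYm : ∀ i k, Y i * mulOdd k = mulOdd k * Y i)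
    (hXY : ∀ i j, X i * Y j = Y j * X i) :
    (dOdd k - ∑ b, mulOdd (p b) * X b) * (dOdd l - ∑ b, mulOdd (q b) * Y b) +
      (dOdd l - ∑ b, mulOdd (q b) * Y b) * (dOdd k - ∑ b, mulOdd (p b) * X b) =
    -(∑ b, (if k = q b then Y b else 0)) - ∑ b, (if l = p b then X b else 0) := by
  -- Differentiating a linear coefficient leaves a Kronecker delta; these cross terms are the whole
  -- answer.
  have h1 (b) : dOdd k * (mulOdd (q b) * Y b) + (mulOdd (q b) * Y b) * dOdd k =
      if k = q b then Y b else 0 := by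
    rw [← mul_assoc, dOdd_mul_mulOdd, mul_assoc, hYd, sub_mul, mul_assoc, sub_add_cancel]
    split_ifs <;> simp
  have h2 (b) : dOdd l * (mulOdd (p b) * X b) + (mulOdd (p b) * X b) * dOdd l =
      if l = p b then X b else 0 := by
    rw [← mul_assoc, dOdd_mul_mulOdd, mul_assoc, hXd, sub_mul, mul_assoc, sub_add_cancel]
    split_ifs <;> simp
  -- The quadratic terms cancel because the coefficients anticommute and the even fields commute.
  have h3 (b c) : (mulOdd (p b) * X b) * (mulOdd (q c) * Y c) +
      (mulOdd (q c) * Y c) * (mulOdd (p b) * X b) = 0 := by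
    linear_combination (norm := noncomm_ring) mulOdd (p b) * hXm b (q c) * Y c +
      mulOdd_mul_mulOdd (p b) (q c) * X b * Y c - mulOdd (q c) * mulOdd (p b) * hXY b c +
      mulOdd (q c) * hYm c (p b) * X b
  simp only [Fin.sum_univ_two]
  linear_combination (norm := noncomm_ring) dOdd_mul_dOdd k l - h1 0 - h1 1 - h2 0 - h2 1 +
    h3 0 0 + h3 0 1 + h3 1 0 + h3 1 1

theorem D_anticomm_D (i a j b : Fin 2) :
    (D i a * D j b + D j b * D i a : Module.End ℂ (SFun N)) = 0 := by
  refine (anticomm_sub_mulOdd_mul (dSpin_mul_dOdd a) (dSpin_mul_mulOdd a) (dSpin_mul_dOdd b)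
    (dSpin_mul_mulOdd b) fun _ _ => dSpin_comm _ _ _ _).trans ?_
  simp [th_ne_thbar]

theorem Dbar_anticomm_Dbar (i a j b : Fin 2) :
    (Dbar i a * Dbar j b + Dbar j b * Dbar i a : Module.End ℂ (SFun N)) = 0 := by
  refine (anticomm_sub_mulOdd_mul (fun c => dSpin_mul_dOdd c a) (fun c => dSpin_mul_mulOdd c a)
    (fun c => dSpin_mul_dOdd c b) (fun c => dSpin_mul_mulOdd c b)
    fun _ _ => dSpin_comm _ _ _ _).trans ?_
  simp [(th_ne_thbar _ _ _ _).symm]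

/-- Each of the two cross terms contributes `-dSpin a b` when the copies agree, hence the factor -2.
-/
theorem D_anticomm_Dbar (i a j b : Fin 2) :
    (D i a * Dbar j b + Dbar j b * D i a : Module.End ℂ (SFun N)) =
      (if i = j then (-2 : ℂ) else 0) • dSpin a b := by
  refine (anticomm_sub_mulOdd_mul (dSpin_mul_dOdd a) (dSpin_mul_mulOdd a)
    (fun c => dSpin_mul_dOdd c b) (fun c => dSpin_mul_mulOdd c b)
    fun _ _ => dSpin_comm _ _ _ _).trans ?_
  by_cases h : i = j
  · subst h
    simp [th_inj, thbar_inj]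
    module
  · simp [th_inj, thbar_inj, h, Ne.symm h]

theorem D_comm_dSpin (i a c d : Fin 2) :
    (D i a * dSpin c d : Module.End ℂ (SFun N)) = dSpin c d * D i a := by
  simp only [D, sub_mul, mul_sub, Finset.sum_mul, Finset.mul_sum, dSpin_mul_dOdd]
  congr 1
  refine Finset.sum_congr rfl fun b _ => ?_
  rw [mul_assoc, dSpin_comm, ← mul_assoc, ← mul_assoc, dSpin_mul_mulOdd]

/-! ## Parity and the Leibniz rules -/

theorem parity_mulOdd (k : OddIdx N) (x : SFun N) :
    parity N (mulOdd k x) = -mulOdd k (parity N x) := by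
  rw [mulOdd_apply, mulOdd_apply, map_mul, parity_tm, involute_gen, tm_neg, neg_mul]

theorem parity_dOdd (k : OddIdx N) (x : SFun N) :
    parity N (dOdd k x) = -dOdd k (parity N x) := by
  induction x using SFun.induction with
  | tm f w => rw [dOdd_tm, parity_tm, parity_tm, dOdd_tm, involute_contr, tm_neg]
  | add x y hx hy => simp only [map_add, hx, hy, neg_add]

theorem parity_dEven (μ : Fin 4) (x : SFun N) :
    parity N (dEven μ x) = dEven μ (parity N x) := by
  induction x using SFun.induction with
  | tm f w => simp only [dEven_tm, parity_tm]
  | add x y hx hy => simp only [map_add, hx, hy]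

theorem mulOdd_comm (k : OddIdx N) (x : SFun N) :
    tm 1 (gen k) * x = parity N x * tm 1 (gen k) := by
  induction x using SFun.induction with
  | tm f w => rw [parity_tm, tm_mul, tm_mul, one_mul, mul_one, gen_mul]
  | add x y hx hy => rw [mul_add, hx, hy, map_add, add_mul]

theorem dOdd_mul (k : OddIdx N) (x y : SFun N) :
    dOdd k (x * y) = dOdd k x * y + parity N x * dOdd k y := by
  induction x using SFun.induction with
  | tm f w =>
    induction y using SFun.induction with
    | tm g v => simp only [dOdd_tm, parity_tm, tm_mul, contr_mul, tm_add]
    | add x y hx hy => simp only [mul_add, map_add, hx, hy]; abel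
  | add x y hx hy => simp only [add_mul, map_add, hx, hy]; abel

theorem dEven_mul (μ : Fin 4) (x y : SFun N) :
    dEven μ (x * y) = dEven μ x * y + x * dEven μ y := by
  induction x using SFun.induction with
  | tm f w =>
    induction y using SFun.induction with
    | tm g v => simp only [dEven_tm, tm_mul, partialFun_mul, add_tm]
    | add x y hx hy => simp only [mul_add, map_add, hx, hy]; abel
  | add x y hx hy => simp only [add_mul, map_add, hx, hy]; abel

/-- Odd vector fields. -/
def oddDer (N : ℕ) : Submodule ℂ (Module.End ℂ (SFun N)) where
  carrier := {X | (∀ x y, X (x * y) = X x * y + parity N x * X y) ∧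
    ∀ x, parity N (X x) = -X (parity N x)}
  add_mem' {X Y} hX hY := by
    refine ⟨fun x y => ?_, fun x => ?_⟩
    · simp only [LinearMap.add_apply, hX.1, hY.1]; noncomm_ring
    · simp only [LinearMap.add_apply, map_add, hX.2, hY.2]; abel
  zero_mem' := by simp
  smul_mem' c X hX := by
    refine ⟨fun x y => ?_, fun x => ?_⟩
    · simp only [LinearMap.smul_apply, hX.1, smul_add, smul_mul_assoc, mul_smul_comm]
    · simp only [LinearMap.smul_apply, map_smul, hX.2, smul_neg]

/-- Even vector fields. -/
def evenDer (N : ℕ) : Submodule ℂ (Module.End ℂ (SFun N)) where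
  carrier := {X | (∀ x y, X (x * y) = X x * y + x * X y) ∧ ∀ x, parity N (X x) = X (parity N x)}
  add_mem' {X Y} hX hY := by
    refine ⟨fun x y => ?_, fun x => ?_⟩
    · simp only [LinearMap.add_apply, hX.1, hY.1]; noncomm_ring
    · simp only [LinearMap.add_apply, map_add, hX.2, hY.2]
  zero_mem' := by simp
  smul_mem' c X hX := by
    refine ⟨fun x y => ?_, fun x => ?_⟩
    · simp only [LinearMap.smul_apply, hX.1, smul_add, smul_mul_assoc, mul_smul_comm]
    · simp only [LinearMap.smul_apply, map_smul, hX.2]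

theorem dEven_mem (μ : Fin 4) : dEven μ ∈ evenDer N := ⟨dEven_mul μ, parity_dEven μ⟩

theorem dOdd_mem (k : OddIdx N) : dOdd k ∈ oddDer N := ⟨dOdd_mul k, parity_dOdd k⟩

/-- The sign in the odd Leibniz rule arises from moving the generator past `x`. -/
theorem mulOdd_mul_mem (k : OddIdx N) {X : Module.End ℂ (SFun N)} (hX : X ∈ evenDer N) :
    mulOdd k * X ∈ oddDer N := by
  refine ⟨fun x y => ?_, fun x => ?_⟩
  · simp only [Module.End.mul_apply, mulOdd_apply, hX.1, mul_add, ← mul_assoc, mulOdd_comm k x]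
  · simp only [Module.End.mul_apply, parity_mulOdd, hX.2]

theorem dSpin_mem (a b : Fin 2) : dSpin a b ∈ evenDer N := by
  have h := dEven_mem (N := N)
  fin_cases a <;> fin_cases b
  · exact Submodule.smul_mem _ _ (sub_mem (h 0) (Submodule.smul_mem _ _ (h 1)))
  · exact Submodule.smul_mem _ _ (sub_mem (h 2) (Submodule.smul_mem _ _ (h 3)))
  · exact Submodule.smul_mem _ _ (sub_mem (neg_mem (h 2)) (Submodule.smul_mem _ _ (h 3)))
  · exact Submodule.smul_mem _ _ (add_mem (h 0) (Submodule.smul_mem _ _ (h 1)))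

theorem D_mem (i a : Fin 2) : D i a ∈ oddDer N :=
  sub_mem (dOdd_mem _) (sum_mem fun _ _ => mulOdd_mul_mem _ (dSpin_mem _ _))

theorem Dbar_mem (i a : Fin 2) : Dbar i a ∈ oddDer N :=
  sub_mem (dOdd_mem _) (sum_mem fun _ _ => mulOdd_mul_mem _ (dSpin_mem _ _))

/-! ## Invariant vector fields as operators on sections of the defining representation -/

/-- Odd invariant vector fields. -/
def oddField (N : ℕ) : Submodule ℂ (InvField N) where
  carrier := {P | P.1 ∈ oddDer N ∧ IsOddMat P.2}
  add_mem' {P Q} hP hQ := ⟨add_mem hP.1 hQ.1, fun p q => by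
    change parity N (P.2 p q + Q.2 p q) = -(P.2 p q + Q.2 p q)
    rw [map_add, hP.2, hQ.2, neg_add]⟩
  zero_mem' := ⟨zero_mem _, fun p q => by simp⟩
  smul_mem' c P hP := ⟨Submodule.smul_mem _ _ hP.1, fun p q => by
    change parity N (c • P.2 p q) = -(c • P.2 p q)
    rw [map_smul, hP.2, smul_neg]⟩

/-- Even invariant vector fields. -/
def evenField (N : ℕ) : Submodule ℂ (InvField N) where
  carrier := {P | P.1 ∈ evenDer N ∧ IsEvenMat P.2}
  add_mem' {P Q} hP hQ := ⟨add_mem hP.1 hQ.1, fun p q => by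
    change parity N (P.2 p q + Q.2 p q) = P.2 p q + Q.2 p q
    rw [map_add, hP.2, hQ.2]⟩
  zero_mem' := ⟨zero_mem _, fun p q => by simp⟩
  smul_mem' c P hP := ⟨Submodule.smul_mem _ _ hP.1, fun p q => by
    change parity N (c • P.2 p q) = c • P.2 p q
    rw [map_smul, hP.2]⟩

theorem isEvenMat_acomm {P Q : InvField N} (hP : P ∈ oddField N) (hQ : Q ∈ oddField N) :
    IsEvenMat (acomm P Q).2 := fun p q => by
  have hP1 := hP.1.2
  have hQ1 := hQ.1.2
  have hP2 := hP.2
  have hQ2 := hQ.2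
  simp only [acomm, Matrix.add_apply, Matrix.map_apply, Matrix.mul_apply, map_add, map_sum,
    map_mul, hP2 _ _, hQ2 _ _, hP1, hQ1, map_neg, neg_neg, neg_mul_neg]

theorem isOddMat_comm {P Q : InvField N} (hP : P ∈ oddField N) (hQ : Q ∈ evenField N) :
    IsOddMat (comm P Q).2 := fun p q => by
  have hP1 := hP.1.2
  have hQ1 := hQ.1.2
  have hP2 := hP.2
  have hQ2 := hQ.2
  simp only [comm, Matrix.add_apply, Matrix.sub_apply, Matrix.map_apply, Matrix.mul_apply, map_add,
    map_sub, map_sum, map_mul, hP2 _ _, hQ2 _ _, hP1, hQ1, map_neg, neg_mul, mul_neg,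
    Finset.sum_neg_distrib]
  abel

theorem vert_mem_oddField {s : SMat N} (hs : IsOddMat s) : vert s ∈ oddField N := ⟨zero_mem _, hs⟩

theorem vert_mem_evenField {s : SMat N} (hs : IsEvenMat s) : vert s ∈ evenField N :=
  ⟨zero_mem _, hs⟩

/-- The action of an invariant vector field on sections of the defining representation. -/
def act : InvField N →ₗ[ℂ] Module.End ℂ (Fin 2 → SFun N) where
  toFun P :=
    { toFun := fun f p => P.1 (f p) + ∑ q, P.2 p q * f q
      map_add' := fun f g => by
        ext p
        simp only [Pi.add_apply, map_add, mul_add, Finset.sum_add_distrib]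
        abel
      map_smul' := fun c f => by
        ext p
        simp only [Pi.smul_apply, map_smul, mul_smul_comm, ← Finset.smul_sum, smul_add,
          RingHom.id_apply] }
  map_add' P Q := by
    refine LinearMap.ext fun f => funext fun p => ?_
    simp only [LinearMap.add_apply, Pi.add_apply, LinearMap.coe_mk, AddHom.coe_mk, Prod.fst_add,
      Prod.snd_add, Matrix.add_apply, add_mul, Finset.sum_add_distrib]
    abel
  map_smul' c P := by
    refine LinearMap.ext fun f => funext fun p => ?_
    simp only [LinearMap.smul_apply, Pi.smul_apply, LinearMap.coe_mk, AddHom.coe_mk, Prod.smul_fst,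
      Prod.smul_snd, Matrix.smul_apply, smul_mul_assoc, ← Finset.smul_sum, smul_add,
      RingHom.id_apply]

theorem act_apply (P : InvField N) (f : Fin 2 → SFun N) (p : Fin 2) :
    act P f p = P.1 (f p) + ∑ q, P.2 p q * f q := rfl

/-- In `P.1 (Q.2 * f)` the Leibniz rule produces `-Q.2 * P.1 f`, as `Q.2` is odd; this cancels
against the other ordering, and no derivative of `f` meets a matrix. -/
theorem act_acomm {P Q : InvField N} (hP : P ∈ oddField N) (hQ : Q ∈ oddField N) :
    act (acomm P Q) = act P * act Q + act Q * act P := by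
  refine LinearMap.ext fun f => funext fun p => ?_
  have hP2 := hP.2
  have hQ2 := hQ.2
  simp only [Module.End.mul_apply, LinearMap.add_apply, Pi.add_apply, act_apply, acomm,
    Matrix.add_apply, Matrix.map_apply, Matrix.mul_apply, map_add, Fin.sum_univ_two, hP.1.1, hQ.1.1,
    hP2 _ _, hQ2 _ _]
  noncomm_ring

theorem act_comm {P Q : InvField N} (hP : P ∈ oddField N) (hQ : Q ∈ evenField N) :
    act (comm P Q) = act P * act Q - act Q * act P := by
  refine LinearMap.ext fun f => funext fun p => ?_
  have hP2 := hP.2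
  have hQ2 := hQ.2
  simp only [Module.End.mul_apply, LinearMap.sub_apply, Pi.sub_apply, act_apply, comm,
    Matrix.add_apply, Matrix.sub_apply, Matrix.map_apply, Matrix.mul_apply, map_add,
    Fin.sum_univ_two, hP.1.1, hQ.1.1, hQ2 _ _]
  noncomm_ring

theorem act_vert_mul (s t : SMat N) : act (vert (s * t)) = act (vert s) * act (vert t) := by
  refine LinearMap.ext fun f => funext fun p => ?_
  simp only [Module.End.mul_apply, act_apply, vert, Matrix.mul_apply, Fin.sum_univ_two,
    LinearMap.zero_apply]
  noncomm_ring

/-- Applied to the constant basis sections, a vertical field returns the columns of its matrix. -/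
theorem act_vert_injective : Function.Injective fun s : SMat N => act (vert s) := by
  intro s t h
  ext p q
  have h' := congrFun (LinearMap.congr_fun h (Pi.single q 1)) p
  simpa [act_apply, vert, Pi.single_apply] using h'

theorem vert_add (s t : SMat N) : vert (s + t) = vert s + vert t := by
  simp [vert]

theorem vert_sub (s t : SMat N) : vert (s - t) = vert s - vert t := by
  simp [vert]

theorem vert_smul (c : ℂ) (s : SMat N) : vert (c • s) = c • vert s := by
  simp [vert]

theorem vert_snd {P : InvField N} (h : P.1 = 0) : vert P.2 = P := Prod.ext h.symm rfl

/-! ## Bilinearity of the brackets -/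

theorem map_add_apply (X : Module.End ℂ (SFun N)) (s t : SMat N) :
    (s + t).map X = s.map X + t.map X := Matrix.map_add X (map_add X) s t

theorem map_smul_apply (X : Module.End ℂ (SFun N)) (c : ℂ) (s : SMat N) :
    (c • s).map X = c • s.map X := Matrix.map_smul X c (map_smul X c) s

theorem map_end_add (X Y : Module.End ℂ (SFun N)) (s : SMat N) :
    s.map (X + Y) = s.map X + s.map Y := rfl

theorem map_end_smul (c : ℂ) (X : Module.End ℂ (SFun N)) (s : SMat N) :
    s.map (c • ⇑X) = c • s.map X := rfl

/-- The bracket of odd invariant vector fields as a bilinear map. -/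
def acommL : InvField N →ₗ[ℂ] InvField N →ₗ[ℂ] InvField N :=
  LinearMap.mk₂ ℂ acomm
    (fun P Q R => Prod.ext (by simp [acomm]; noncomm_ring)
      (by simp [acomm, map_add_apply, map_end_add, add_mul, mul_add]; abel))
    (fun c P R => Prod.ext (by simp [acomm])
      (by simp [acomm, map_smul_apply, map_end_smul]))
    (fun P Q R => Prod.ext (by simp [acomm]; noncomm_ring)
      (by simp [acomm, map_add_apply, map_end_add, add_mul, mul_add]; abel))
    (fun c P R => Prod.ext (by simp [acomm])
      (by simp [acomm, map_smul_apply, map_end_smul]))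

theorem acomm_eq (P Q : InvField N) : acomm P Q = acommL P Q := rfl

/-- The bracket with an even invariant vector field as a bilinear map. -/
def commL : InvField N →ₗ[ℂ] InvField N →ₗ[ℂ] InvField N :=
  LinearMap.mk₂ ℂ comm
    (fun P Q R => Prod.ext (by simp [comm]; noncomm_ring)
      (by simp [comm, map_add_apply, map_end_add, add_mul, mul_add]; abel))
    (fun c P R => Prod.ext (by simp [comm, smul_sub])
      (by simp [comm, map_smul_apply, map_end_smul, smul_sub]))
    (fun P Q R => Prod.ext (by simp [comm]; noncomm_ring)
      (by simp [comm, map_add_apply, map_end_add, add_mul, mul_add]; abel))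
    (fun c P R => Prod.ext (by simp [comm, smul_sub])
      (by simp [comm, map_smul_apply, map_end_smul, smul_sub]))

theorem comm_eq (P Q : InvField N) : comm P Q = commL P Q := rfl

/-! ### Super Jacobi identities in an associative algebra. -/

/-- The super Jacobi identity for the bracket of `x` with `[y, z]`, when `[x, z] = 0` and `[x, y]`
is a multiple of `s`. -/
theorem comm_anticomm_eq {R : Type*} [Ring R] [Algebra ℂ R] {x y z s : R} {k : ℂ}
    (h1 : x * y + y * x = -k • s) (h2 : x * z + z * x = 0) (c : ℂ) :
    x * (c • (y * z + z * y)) - (c • (y * z + z * y)) * x = (c * k) • (z * s - s * z) := by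
  have h3 : x * (y * z + z * y) - (y * z + z * y) * x =
      (x * y + y * x) * z - z * (x * y + y * x) - y * (x * z + z * x) + (x * z + z * x) * y := by
    simp only [mul_add, add_mul, mul_assoc]
    abel
  rw [mul_smul_comm, smul_mul_assoc, ← smul_sub, h3, h1, h2, mul_zero, zero_mul, add_zero, sub_zero,
    smul_mul_assoc, mul_smul_comm]
  module

/-- The super Jacobi identity for `[x, [y, s]] + [y, [x, s]]`. -/
theorem anticomm_comm_add_swap {R : Type*} [Ring R] [Algebra ℂ R] {x y s t : R} {k : ℂ}
    (h : x * y + y * x = k • t) :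
    (x * (y * s - s * y) + (y * s - s * y) * x) + (y * (x * s - s * x) + (x * s - s * x) * y) =
      k • (t * s - s * t) := by
  rw [smul_sub, ← smul_mul_assoc, ← mul_smul_comm, ← h]
  simp only [mul_add, add_mul, mul_sub, sub_mul, mul_assoc]
  abel

/-! ### Consequences of the semi-constraint. -/

namespace SuperConnection

variable (Γ : SuperConnection N)

theorem hD_mem (i a : Fin 2) : Γ.hD i a ∈ oddField N := ⟨D_mem i a, Γ.odd_A i a⟩

theorem hDbar_mem (i a : Fin 2) : Γ.hDbar i a ∈ oddField N := ⟨Dbar_mem i a, Γ.odd_Abar i a⟩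

theorem hSpin_mem (a b : Fin 2) : Γ.hSpin a b ∈ evenField N := ⟨dSpin_mem a b, Γ.even_Aeven a b⟩

theorem isEvenMat_SigBar : IsEvenMat Γ.SigBar := isEvenMat_acomm (Γ.hD_mem _ _) (Γ.hD_mem _ _)

/-- The covariant derivative `𝒟̄_ȧ^{(i)} Σ̄`. -/
def dSigBar (i a : Fin 2) : SMat N := (comm (Γ.hDbar i a) (vert Γ.SigBar)).2

theorem isOddMat_dSigBar (i a : Fin 2) : IsOddMat (Γ.dSigBar i a) :=
  isOddMat_comm (Γ.hDbar_mem i a) (vert_mem_evenField Γ.isEvenMat_SigBar)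

theorem vert_dSigBar (i a : Fin 2) :
    vert (Γ.dSigBar i a) = comm (Γ.hDbar i a) (vert Γ.SigBar) :=
  vert_snd (by simp [comm, vert])

theorem act_dSigBar (i a : Fin 2) : act (vert (Γ.dSigBar i a)) =
    act (Γ.hDbar i a) * act (vert Γ.SigBar) - act (vert Γ.SigBar) * act (Γ.hDbar i a) := by
  rw [vert_dSigBar, act_comm (Γ.hDbar_mem i a) (vert_mem_evenField Γ.isEvenMat_SigBar)]

theorem ddSigBar_eq (i a j b : Fin 2) :
    Γ.ddSigBar i a j b = (acomm (Γ.hDbar i a) (vert (Γ.dSigBar j b))).2 := by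
  rw [vert_dSigBar]; rfl

theorem act_ddSigBar (i a j b : Fin 2) : act (vert (Γ.ddSigBar i a j b)) =
    act (Γ.hDbar i a) * act (vert (Γ.dSigBar j b)) +
      act (vert (Γ.dSigBar j b)) * act (Γ.hDbar i a) := by
  rw [ddSigBar_eq, vert_snd (by simp [acomm, vert]),
    act_acomm (Γ.hDbar_mem i a) (vert_mem_oddField (Γ.isOddMat_dSigBar j b))]

variable {Γ} (hΓ : Γ.IsSemiConstrained)
include hΓ

theorem IsSemiConstrained.act_hD_hD (i a j b : Fin 2) :
    act (Γ.hD i a) * act (Γ.hD j b) + act (Γ.hD j b) * act (Γ.hD i a) =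
      -(eps2d a b * eps2d i j) • act (vert Γ.SigBar) := by
  rw [← act_acomm (Γ.hD_mem i a) (Γ.hD_mem j b), ← map_smul, ← vert_smul, ← hΓ.curvDD]
  -- The base components anticommute, so the bracket is vertical and equals the curvature.
  exact congrArg act (vert_snd (D_anticomm_D i a j b)).symm

theorem IsSemiConstrained.act_hDbar_hDbar (i a j b : Fin 2) :
    act (Γ.hDbar i a) * act (Γ.hDbar j b) + act (Γ.hDbar j b) * act (Γ.hDbar i a) =
      -(eps2d a b * eps2d i j) • act (vert Γ.Sig) := by
  rw [← act_acomm (Γ.hDbar_mem i a) (Γ.hDbar_mem j b), ← map_smul, ← vert_smul,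
    ← hΓ.curvDbarDbar]
  exact congrArg act (vert_snd (Dbar_anticomm_Dbar i a j b)).symm

theorem IsSemiConstrained.act_hD_hDbar (i a j b : Fin 2) :
    act (Γ.hD i a) * act (Γ.hDbar j b) + act (Γ.hDbar j b) * act (Γ.hD i a) =
      (if i = j then (-2 : ℂ) else 0) • act (Γ.hSpin a b) := by
  rw [← act_acomm (Γ.hD_mem i a) (Γ.hDbar_mem j b), ← map_smul]
  exact congrArg act (Prod.ext (D_anticomm_Dbar i a j b) (sub_eq_zero.1 (hΓ.curvDDbar i a j b)))

/-- The curvature of a semi-constrained superconnection on `D_c^{(j)}, ∂_{aḃ}`. -/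
theorem IsSemiConstrained.act_hD_comm_hSpin {i j : Fin 2} (hij : i ≠ j) (a b c : Fin 2) :
    act (Γ.hD j c) * act (Γ.hSpin a b) - act (Γ.hSpin a b) * act (Γ.hD j c) =
      (-(1 / 2) * (eps2d c a * eps2d j i)) • act (vert (Γ.dSigBar i b)) := by
  have h1 := hΓ.act_hD_hD j c i a
  have h2 := hΓ.act_hD_hDbar i a i b
  have h3 := hΓ.act_hD_hDbar j c i b
  rw [if_pos rfl] at h2
  rw [if_neg hij.symm, zero_smul] at h3
  rw [act_dSigBar]
  -- The even operator is written through copy `i`, not `j`: then `hD j c` has zero bracket with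
  -- `hDbar i b`, and one Jacobi term drops out.
  have h4 : act (Γ.hSpin a b) = (-(1 / 2) : ℂ) •
      (act (Γ.hD i a) * act (Γ.hDbar i b) + act (Γ.hDbar i b) * act (Γ.hD i a)) := by
    rw [h2, smul_smul]; norm_num
  rw [h4]
  exact comm_anticomm_eq h1 h3 _

theorem IsSemiConstrained.hD0_comm_hSpin (a b : Fin 2) :
    comm Γ.hD0 (Γ.hSpin a b) = (-(1 / 2) : ℂ) • vert (Γ.dSigBar a b) := by
  have h0 : (comm Γ.hD0 (Γ.hSpin a b)).1 = 0 := by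
    change (D 0 0 + D 1 1) * dSpin a b - dSpin a b * (D 0 0 + D 1 1) = 0
    rw [add_mul, mul_add, D_comm_dSpin, D_comm_dSpin, sub_self]
  have hD0 : Γ.hD0 ∈ oddField N := add_mem (Γ.hD_mem 0 0) (Γ.hD_mem 1 1)
  rw [← vert_snd h0, ← vert_smul]
  congr 1
  apply act_vert_injective
  change act (vert _) = act (vert _)
  rw [vert_snd h0, act_comm hD0 (Γ.hSpin_mem a b), vert_smul, map_smul,
    show Γ.hD0 = Γ.hD 0 0 + Γ.hD 1 1 from rfl, map_add]
  -- Each summand of `hD0` is paired with the opposite copy. The factor `eps2d c a` then keeps only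
  -- the first summand for `a = 1` and only the second for `a = 0`.
  have h1 := hΓ.act_hD_comm_hSpin one_ne_zero a b 0
  have h2 := hΓ.act_hD_comm_hSpin zero_ne_one a b 1
  rw [add_mul, mul_add, add_sub_add_comm, h1, h2]
  fin_cases a <;> simp [eps2d]

/-- By Jacobi, the sum over both orders is the action of the bracket of the two `hDbar`, which is a
multiple of `Sig`, on `SigBar`. -/
theorem IsSemiConstrained.ddSigBar_add_swap (i a j b : Fin 2) :
    Γ.ddSigBar i a j b + Γ.ddSigBar j b i a =
      -(eps2d a b * eps2d i j) • (Γ.Sig * Γ.SigBar - Γ.SigBar * Γ.Sig) := by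
  apply act_vert_injective
  change act (vert _) = act (vert _)
  rw [vert_add, vert_smul, vert_sub, map_add, map_smul, map_sub, act_ddSigBar, act_ddSigBar,
    act_dSigBar, act_dSigBar, act_vert_mul, act_vert_mul,
    anticomm_comm_add_swap (hΓ.act_hDbar_hDbar i a j b)]

end SuperConnection

/-! ### Self-dual projection in spinor components. -/

section VectorComponents

variable {M M' : Type*} [AddCommGroup M] [Module ℂ M] [AddCommGroup M'] [Module ℂ M']

/-- The components with respect to `v₁, …, v₄` of a covector with the components `f a b` with
respect to `e_{aḃ}`. -/
def vecComp (f : Fin 2 → Fin 2 → M) : Fin 4 → M :=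
  ![f 0 0 + f 1 1, Complex.I • f 0 0 - Complex.I • f 1 1,
    f 0 1 - f 1 0, Complex.I • f 0 1 + Complex.I • f 1 0]

theorem map_vecComp (φ : M →ₗ[ℂ] M') (f : Fin 2 → Fin 2 → M) (μ : Fin 4) :
    φ (vecComp f μ) = vecComp (fun a b => φ (f a b)) μ := by
  fin_cases μ <;> simp [vecComp]

/-- The self-dual part of a 2-tensor with the spinor components `W a b c d`, if the symmetric part
of `W` is a multiple of the metric. -/
theorem eps2_vecComp {W : Fin 2 → Fin 2 → Fin 2 → Fin 2 → M} {C : M}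
    (hW : ∀ i a j b, W i a j b + W j b i a = -(eps2d a b * eps2d i j) • C) (μ ν : Fin 4) :
    eps2 (fun α β => vecComp (fun i a => vecComp (W i a) β) α) μ ν =
      omega1 μ ν • (-4 * Complex.I) • (-(W 0 1 1 0 - W 0 0 1 1) + C)
        + omega2 μ ν • (4 : ℂ) • (W 0 0 0 1 - W 1 1 1 0)
        + omega3 μ ν • (4 * Complex.I) • (W 1 1 1 0 + W 0 0 0 1) := by
  -- At equal index pairs `eps2d` vanishes, so twice the component is zero.
  have h0 (i a) : W i a i a = 0 := by
    have := hW i a i a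
    fin_cases i <;> simpa [eps2d, ← two_smul ℂ] using this
  -- For each of the six unordered pairs of distinct indices one order is eliminated, leaving six
  -- components and `C`.
  have e1 : W 0 1 0 0 = -W 0 0 0 1 := by simpa [eps2d] using eq_sub_of_add_eq' (hW 0 0 0 1)
  have e2 : W 1 0 0 0 = -W 0 0 1 0 := by simpa [eps2d] using eq_sub_of_add_eq' (hW 0 0 1 0)
  have e3 : W 1 1 0 0 = -C - W 0 0 1 1 := by simpa [eps2d] using eq_sub_of_add_eq' (hW 0 0 1 1)
  have e4 : W 1 0 0 1 = C - W 0 1 1 0 := by simpa [eps2d] using eq_sub_of_add_eq' (hW 0 1 1 0)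
  have e5 : W 1 1 0 1 = -W 0 1 1 1 := by simpa [eps2d] using eq_sub_of_add_eq' (hW 0 1 1 1)
  have e6 : W 1 0 1 1 = -W 1 1 1 0 := by simpa [eps2d] using eq_sub_of_add_eq' (hW 1 1 1 0)
  fin_cases μ <;> fin_cases ν <;>
    simp [eps2, hodge, vecComp, omega1, omega2, omega3, h0, e1, e2, e3, e4, e5, e6] <;>
    match_scalars <;> ring_nf <;> simp <;> norm_num

end VectorComponents

/-! ### The tensor underlying `E2`. -/

namespace SuperConnection

variable {Γ : SuperConnection N}

/-- The signs from raising the copy index cancel those in `hD1`: the copy index simply takes the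
place of the undotted spinor index. -/
theorem hD1_eq (μ : Fin 4) : Γ.hD1 μ = vecComp Γ.hDbar μ := by
  fin_cases μ <;> simp [hD1, hDbarUp, vecComp] <;> abel

theorem hNabla_eq (μ : Fin 4) : Γ.hNabla μ = vecComp Γ.hSpin μ := rfl

variable (hΓ : Γ.IsSemiConstrained)
include hΓ

theorem IsSemiConstrained.vert_brD0Nabla (μ : Fin 4) :
    vert (Γ.brD0Nabla μ) =
      vecComp (fun a b => (-(1 / 4) : ℂ) • vert (Γ.dSigBar a b)) μ := by
  have h : comm Γ.hD0 (Γ.hNabla μ) =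
      vecComp (fun a b => (-(1 / 2) : ℂ) • vert (Γ.dSigBar a b)) μ := by
    rw [hNabla_eq, comm_eq, map_vecComp]
    simp only [← comm_eq, hΓ.hD0_comm_hSpin]
  have h0 : (comm Γ.hD0 (Γ.hNabla μ)).1 = 0 := by
    rw [h]
    fin_cases μ <;> simp [vecComp, vert]
  rw [brD0Nabla, vert_smul, vert_snd h0, h]
  -- The normalization 1/2 of the bracket turns -1/2 into -1/4.
  refine (map_vecComp (LinearMap.lsmul ℂ (InvField N) (1 / 2)) _ μ).trans ?_
  simp only [LinearMap.lsmul_apply, smul_smul]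
  norm_num

theorem IsSemiConstrained.hD1_brD0Nabla (μ ν : Fin 4) :
    (acomm (Γ.hD1 μ) (vert (Γ.brD0Nabla ν))).2 =
      vecComp (fun i a => vecComp (fun j b => (-(1 / 4) : ℂ) • Γ.ddSigBar i a j b) ν) μ := by
  rw [hΓ.vert_brD0Nabla, hD1_eq, acomm_eq]
  -- Bilinearity of the bracket moves it inside the component expansion, here in the first slot and
  -- below in the second.
  refine (map_vecComp ((LinearMap.snd ℂ _ _).comp (acommL.flip _)) _ _).trans ?_
  congr! 3 with i a
  refine (map_vecComp ((LinearMap.snd ℂ _ _).comp (acommL (Γ.hDbar i a))) _ _).trans ?_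
  simp only [map_smul, ddSigBar_eq]
  rfl

theorem IsSemiConstrained.ddSigBar_swap (i a j b : Fin 2) :
    Γ.ddSigBar j b i a = -(eps2d a b * eps2d i j) • (Γ.Sig * Γ.SigBar - Γ.SigBar * Γ.Sig) -
      Γ.ddSigBar i a j b :=
  eq_sub_of_add_eq' (hΓ.ddSigBar_add_swap i a j b)

end SuperConnection

/-! ### Restriction as a ring homomorphism. -/

theorem restrict_mul (s t : SMat N) : restrict (s * t) = restrict s * restrict t :=
  map_mul (restrictFun N).mapMatrix s t

theorem restrict_add (s t : SMat N) : restrict (s + t) = restrict s + restrict t :=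
  map_add (restrictFun N).mapMatrix s t

theorem restrict_neg (s : SMat N) : restrict (-s) = -restrict s :=
  map_neg (restrictFun N).mapMatrix s

theorem restrict_sub (s t : SMat N) : restrict (s - t) = restrict s - restrict t :=
  map_sub (restrictFun N).mapMatrix s t

theorem restrict_smul (c : ℂ) (s : SMat N) : restrict (c • s) = c • restrict s :=
  map_smul (restrictFun N).mapMatrix c s

end TwistedSusy

end

theorem mainTheorem9 (N : ℕ) (Γ : TwistedSusy.SuperConnection N) (hΓ : Γ.IsSemiConstrained) :
    (∀ μ ν : Fin 4, Γ.E2 μ ν =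
      TwistedSusy.omega1 μ ν • (Complex.I / 2) •
          (Γ.auxE + (Γ.sigma * Γ.sigmaBar - Γ.sigmaBar * Γ.sigma))
        + TwistedSusy.omega2 μ ν • (-1 / 2 : ℂ) • (Γ.auxFbar - Γ.auxF)
        + TwistedSusy.omega3 μ ν • (-Complex.I / 2) • (Γ.auxF + Γ.auxFbar)) ∧
    Γ.auxE + (Γ.sigma * Γ.sigmaBar - Γ.sigmaBar * Γ.sigma) = Γ.auxEAnti := by
  open TwistedSusy SuperConnection in
  refine ⟨fun μ ν => ?_, ?_⟩
  · have h := eps2_vecComp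
      (W := fun i a j b => (-(1 / 4) : ℂ) • Γ.ddSigBar i a j b)
      (C := (-(1 / 4) : ℂ) • (Γ.Sig * Γ.SigBar - Γ.SigBar * Γ.Sig))
      (fun i a j b => by rw [← smul_add, hΓ.ddSigBar_add_swap, smul_comm]) μ ν
    simp only [← hΓ.hD1_brD0Nabla] at h
    rw [E2, h]
    simp only [auxE, auxF, auxFbar, sigma, sigmaBar, restrict_mul, restrict_add, restrict_sub,
      restrict_neg, restrict_smul]
    -- The constants are 1/2 · (-1/4) times -4i, 4 and 4i, that is i/2, -1/2 and -i/2.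
    module
  -- Reordering each of the two reversed terms contributes half of the commutator.
  · have h1 := hΓ.ddSigBar_swap 0 1 1 0
    have h2 := hΓ.ddSigBar_swap 0 0 1 1
    simp only [auxE, auxEAnti, sigma, sigmaBar, h1, h2, restrict_mul, restrict_sub, restrict_smul]
    simp only [eps2d, Matrix.of_apply, Matrix.cons_val]
    module
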